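/- Let $G=([n],E)$ be a finite simple graph and let $<$ be a total order on its edges. Let $\Delta_{G,<}$ be the simplicial complex whose vertices are all oriented edges $i\to j$ of $G$ (identified with the vertices $e_i-e_j$ of the symmetric edge polytope $\mathcal P_G=\operatorname{conv}(\pm(e_i-e_j): ij\in E)$), and in which a set of oriented edges is a non-face if and only if it contains at least one of the following: (i) an antipodal pair $\{i\to j,\ j\to i\}$; (ii) an $m$-element subset of an oriented $(2m-1)$-cycle of $G$; (iii) an $m$-element subset of an oriented $2m$-cycle of $G$ that does not contain the $<$-minimal edge of this cycle. ($\Delta_{G,<}$ is a unimodular triangulation of the boundary of $\mathcal P_G$.) For every $n$ and every graph $G$ on $[n]$ fix a total order on the edges of $G$ and write $\Delta_G$ for the resulting complex. Let $f_{\ell-1}(G)$ be the number of $(\ell-1)$-dimensional faces ($\ell$-element faces) of $\Delta_G$, and let $n_{\ell-1}(G)$ be the number of $\ell$-element non-faces of $\Delta_G$ that contain no antipodal pair. Let $0<\beta<1$, $\alpha=\min\left(\tfrac12,\tfrac{\beta}{2-\beta}\right)$ and let $k\ge 1$ be an integer. Let $G\in G(n,p)$ be the Erdős–Rényi random graph with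 $p=n^{-\beta}$, let $X_E$ be its number of edges, and for real $x$ put $\binom{x}{\ell}=\frac{x(x-1)\cdots(x-\ell+1)}{\ell!}$. The constants $B_0,c,C$ below depend only on $\beta$ and $k$. 1. There is $B_0>0$ such that for all $B\ge B_0$ and all choices of the orders $$\lim_{n\to\infty}\mathbb P\left(n_{\ell-1}\le B\,\mathbb E(X_E)^{\ell-\alpha}\ \text{ for all } 2\le \ell\le k+1\right)=1 .$$ 2. There is $B_0>0$ such that for all $B\ge B_0$, all $\varepsilon>0$ and all choices of the orders $$\lim_{n\to\infty}\mathbb P\left(2^{\ell-\varepsilon}\binom{\mathbb E(X_E)}{\ell}-B\,\mathbb E(X_E)^{\ell-\alpha}\le f_{\ell-1}\le 2^{\ell+\varepsilon}\binom{\mathbb E(X_E)}{\ell}\ \text{ for all } 1\le \ell\le k\right)=1 .$$ 3. In particular, asymptotically almost surely $f_{\ell-1}\in\Theta(n^{(2-\beta)\ell})$ for all $1\le\ell\le k$; that is, there are constants $c,C>0$ such that for all choices of the orders $$\lim_{n\to\infty}\mathbb P\left(c\,n^{(2-\beta)\ell}\le f_{\ell-1}\le C\,n^{(2-\beta)\ell}\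 \text{ for all } 1\le \ell\le k\right)=1 .$$ -/

import Mathlib

open MeasureTheory Filter Topology

namespace SymEdge

variable {V : Type*} {G : SimpleGraph V}

/-- `F` contains an antipodal pair, i.e. both orientations `i → j` and `j → i` of an edge.
Oriented edges `i → j` of `G` are Mathlib's darts; they are identified with the vertices
`e_i - e_j` of the symmetric edge polytope of `G`. -/
def HasAntipodalPair (F : Finset G.Dart) : Prop :=
  ∃ d ∈ F, d.symm ∈ F

/-- The underlying edge of `d` is the smallest edge of the closed walk `c`
with respect to the total order `ord` on the edges of `G`. -/
def IsMinEdgeOf (ord : LinearOrder G.edgeSet) {v : V} (c : G.Walk v v) (d : G.Dart) : Prop :=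
  d.edge ∈ c.edges ∧ ∀ e : G.edgeSet, (e : Sym2 V) ∈ c.edges → ord.le ⟨d.edge, d.edge_mem⟩ e

/-- `S` is an `ℓ`-element subset of an oriented `(2ℓ-1)`-cycle of `G`. An oriented cycle is
the set of darts of a closed walk that is a cycle, traversed in the direction of the walk. -/
def IsHalfOfOddCycle (S : Finset G.Dart) : Prop :=
  ∃ (v : V) (c : G.Walk v v), c.IsCycle ∧ c.length + 1 = 2 * S.card ∧ ∀ d ∈ S, d ∈ c.darts

/-- `S` is an `ℓ`-element subset of an oriented `2ℓ`-cycle of `G`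
not containing the minimal edge of that cycle. -/
def IsHalfOfEvenCycle (ord : LinearOrder G.edgeSet) (S : Finset G.Dart) : Prop :=
  ∃ (v : V) (c : G.Walk v v), c.IsCycle ∧ c.length = 2 * S.card ∧
    ∀ d ∈ S, d ∈ c.darts ∧ ¬ IsMinEdgeOf ord c d

/-- The condition for a set of oriented edges to be a non-face of the triangulation. -/
def IsNonface (ord : LinearOrder G.edgeSet) (F : Finset G.Dart) : Prop :=
  HasAntipodalPair F ∨ ∃ S ⊆ F, IsHalfOfOddCycle S ∨ IsHalfOfEvenCycle ord S

theorem IsNonface.mono {ord : LinearOrder G.edgeSet} {F F' : Finset G.Dart} (h : F ⊆ F')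
    (hF : IsNonface ord F) : IsNonface ord F' := by
  rcases hF with ⟨d, h1, h2⟩ | ⟨S, hS, h'⟩
  · exact Or.inl ⟨d, h h1, h h2⟩
  · exact Or.inr ⟨S, hS.trans h, h'⟩

theorem not_isNonface_singleton (ord : LinearOrder G.edgeSet) (d : G.Dart) :
    ¬ IsNonface ord {d} := by
  rintro (⟨e, h1, h2⟩ | ⟨S, hS, ⟨v, c, hc, hl, -⟩ | ⟨v, c, hc, hl, -⟩⟩)
  · rw [Finset.mem_singleton] at h1 h2
    subst h1
    exact e.symm_ne h2
  · have h3 := hc.three_le_length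
    have h4 := Finset.card_le_card hS
    rw [Finset.card_singleton] at h4
    omega
  · have h3 := hc.three_le_length
    have h4 := Finset.card_le_card hS
    rw [Finset.card_singleton] at h4
    omega

/-- The triangulation `Δ_<` of the boundary of the symmetric edge polytope of `G` given by the
total order `<` on the edges of `G`, as a simplicial complex on the oriented edges of `G`
(every oriented edge is a vertex; as usual in Mathlib the empty face is not recorded). -/
def triangulation (G : SimpleGraph V) (ord : LinearOrder G.edgeSet) :
    AbstractSimplicialComplex G.Dart where
  faces := {F | F.Nonempty ∧ ¬ IsNonface ord F}
  isRelLowerSet_faces := fun _ hF =>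
    ⟨hF.1, fun _ hsub hne => ⟨hne, fun h => hF.2 (h.mono hsub)⟩⟩
  singleton_mem := fun d => ⟨Finset.singleton_nonempty d, not_isNonface_singleton ord d⟩

/-- `f_{ℓ-1}`: the number of `(ℓ-1)`-dimensional faces, i.e. faces with `ℓ` elements. -/
noncomputable def numFaces (G : SimpleGraph V) (ord : LinearOrder G.edgeSet) (l : ℕ) : ℕ :=
  {F : Finset G.Dart | F ∈ (triangulation G ord).faces ∧ F.card = l}.ncard

/-- `n_{ℓ-1}`: the number of `(ℓ-1)`-dimensional non-faces, i.e. `ℓ`-element sets of vertices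
that are not faces, that do not contain antipodal vertices. -/
noncomputable def numNonfaces (G : SimpleGraph V) (ord : LinearOrder G.edgeSet) (l : ℕ) : ℕ :=
  {F : Finset G.Dart | F ∉ (triangulation G ord).faces ∧ ¬ HasAntipodalPair F ∧
    F.card = l}.ncard

theorem rpow_neg_mem_unitInterval {β : ℝ} (hβ : 0 < β) (n : ℕ) :
    (n : ℝ) ^ (-β) ∈ unitInterval := by
  refine ⟨Real.rpow_nonneg (Nat.cast_nonneg n) _, ?_⟩
  rcases Nat.eq_zero_or_pos n with rfl | hn
  · rw [Nat.cast_zero, Real.zero_rpow (by linarith)]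
    exact zero_le_one
  · exact Real.rpow_le_one_of_one_le_of_nonpos (by exact_mod_cast hn) (by linarith)

/-- The law of the Erdős–Rényi random graph `G(n, p)` on `n` labelled vertices
with edge probability `p = n ^ (-β)`. -/
noncomputable def erdosRenyi {β : ℝ} (hβ : 0 < β) (n : ℕ) : Measure (SimpleGraph (Fin n)) :=
  SimpleGraph.binomialRandom (Fin n) ⟨(n : ℝ) ^ (-β), rpow_neg_mem_unitInterval hβ n⟩

/-- `𝔼(X_E)`: the expected number of edges of the random graph. -/
noncomputable def expectedEdges {β : ℝ} (hβ : 0 < β) (n : ℕ) : ℝ :=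
  ∫ G, (G.edgeSet.ncard : ℝ) ∂(erdosRenyi hβ n)

end SymEdge

/-! A set of `l` oriented edges without antipodal pair is a choice of `l` edges with an orientation
of each, so with X edges there are 2^l binom(X, l) of them, and each is either a face or one of the
non-faces counted by `numNonfaces`. The theorem thus says that X is concentrated and that the
non-faces are of lower order.

A non-face without antipodal pair contains `m` ≥ 2 darts of an oriented cycle of length L = 2m-1 or
2m. Forgetting the edge order only enlarges this family. Choosing the cycle, the part of it that is
used and the remaining `l - m` darts bounds its size by (number of L-cycles) · 2^L · (2X)^(l-m)
(`numNonfaces_le`).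

Write μ = E(X), which has order n^(2-β). The expected number of L-cycles is at most (np)^L =
n^((1-β)L). Markov's inequality makes the number of L-cycles at most μ^(m-α) asymptotically almost
surely, because (2-β)(m-α) - 2(1-β)m = βm - (2-β)α ≥ β(m-1) > 0 (`tendsto_prob_many_cycles`). Of α
this uses only α < 1 and (2-β)α ≤ β. Chebyshev's inequality gives |X - μ| ≤ μ^(3/4) asymptotically
almost surely (`tendsto_prob_edges_far`). On the intersection of these events, `typicalGraphs`, all
the bounds are deterministic. That event does not involve the edge order, which gives uniformity
over all choices of orders. -/

namespace SymEdge

/-! ### Moments of edge and cycle counts in the binomial random graph -/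

section RandomGraph

open ProbabilityTheory

variable {V : Type*}

instance [Finite V] : MeasurableSingletonClass (SimpleGraph V) where
  measurableSet_singleton G := by
    have h : ({G} : Set (SimpleGraph V)) = SimpleGraph.edgeSet ⁻¹' {G.edgeSet} := by
      ext H; simp
    rw [h]
    exact SimpleGraph.measurable_edgeSet (Set.toFinite _).measurableSet

/-- The probability that a binomial random graph contains a given set of edges. -/
theorem binomialRandom_real_subset_edgeSet [Finite V] (p : unitInterval) (T : Finset (Sym2 V))
    (hT : ∀ e ∈ T, ¬ e.IsDiag) :
    (SimpleGraph.binomialRandom V p).real {G | ∀ e ∈ T, e ∈ G.edgeSet} = (p : ℝ) ^ T.card := by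
  have hpre : SimpleGraph.fromEdgeSet ⁻¹' {G : SimpleGraph V | ∀ e ∈ T, e ∈ G.edgeSet} =
      {s : Set (Sym2 V) | ∀ e ∈ T, e ∈ s} := by
    ext s
    simp only [Set.mem_preimage, Set.mem_ofPred_eq, SimpleGraph.edgeSet_fromEdgeSet]
    exact forall₂_congr fun e he => ⟨fun h => h.1, fun h => ⟨h, hT e he⟩⟩
  have hpi : (fun p : Sym2 V → Prop ↦ {i | p i}) ⁻¹' {s : Set (Sym2 V) | ∀ e ∈ T, e ∈ s} =
      Set.pi (T : Set (Sym2 V)) fun _ => {True} := by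
    ext q
    simp [Set.mem_pi]
  rw [measureReal_def, SimpleGraph.binomialRandom_eq_map,
    Measure.map_apply SimpleGraph.measurable_fromEdgeSet (Set.toFinite _).measurableSet, hpre,
    setBernoulli_apply', hpi, Measure.infinitePi_pi _ (fun _ _ => (Set.toFinite _).measurableSet),
    Finset.prod_congr rfl (g := fun _ => (unitInterval.toNNReal p : ENNReal))]
  · simp
  · intro e he
    simp [hT e he]

/-- Linearity of expectation; every moment below is computed by writing a count as a sum of
indicators. -/
theorem integral_card_filter {Ω ι : Type*} [MeasurableSpace Ω] [Finite Ω]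
    [MeasurableSingletonClass Ω] (μ : Measure Ω) [IsFiniteMeasure μ] (s : Finset ι)
    (A : ι → Ω → Prop) [∀ i ω, Decidable (A i ω)] :
    ∫ ω, ((s.filter fun i => A i ω).card : ℝ) ∂μ = ∑ i ∈ s, μ.real {ω | A i ω} := by
  have h : ∀ ω, ((s.filter fun i => A i ω).card : ℝ) =
      ∑ i ∈ s, Set.indicator {ω | A i ω} (fun _ => (1 : ℝ)) ω := by
    intro ω
    simp [Set.indicator_apply]
  simp_rw [h]
  rw [integral_finsetSum _ fun _ _ => Integrable.of_finite]
  refine Finset.sum_congr rfl fun i _ => ?_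
  rw [integral_indicator_const _ (Set.toFinite _).measurableSet]
  simp

theorem ncard_edgeSet_eq_card_filter [Fintype V] (G : SimpleGraph V) [DecidableEq V]
    [∀ e : Sym2 V, Decidable (e ∈ G.edgeSet)] :
    G.edgeSet.ncard =
      (((Finset.univ : Finset (Sym2 V)).filter fun e => ¬ e.IsDiag).filter
        fun e => e ∈ G.edgeSet).card := by
  rw [← Set.ncard_coe_finset]
  congr 1
  ext e
  simpa using fun h => G.not_isDiag_of_mem_edgeSet h

theorem card_filter_not_isDiag (V : Type*) [Fintype V] [DecidableEq V] :
    ((Finset.univ : Finset (Sym2 V)).filter fun e => ¬ e.IsDiag).card =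
      (Fintype.card V).choose 2 := by
  rw [← Sym2.card_diagSet_compl, Fintype.card_subtype]
  congr 1

theorem integral_ncard_edgeSet [Fintype V] (p : unitInterval) :
    ∫ G, (G.edgeSet.ncard : ℝ) ∂(SimpleGraph.binomialRandom V p) =
      (Fintype.card V).choose 2 * (p : ℝ) := by
  classical
  simp_rw [ncard_edgeSet_eq_card_filter]
  rw [integral_card_filter _ _ (fun (e : Sym2 V) (G : SimpleGraph V) => e ∈ G.edgeSet),
    Finset.sum_congr rfl (g := fun _ => (p : ℝ)), Finset.sum_const, card_filter_not_isDiag,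
    nsmul_eq_mul]
  intro e he
  have h := binomialRandom_real_subset_edgeSet p {e} (by simpa using he)
  simpa using h

/-- The variance of the number of edges of a binomial random graph is at most its mean. -/
theorem integral_ncard_edgeSet_sub_sq_le [Fintype V] (p : unitInterval) :
    ∫ G, ((G.edgeSet.ncard : ℝ) - (Fintype.card V).choose 2 * (p : ℝ)) ^ 2
      ∂(SimpleGraph.binomialRandom V p) ≤ (Fintype.card V).choose 2 * (p : ℝ) := by
  classical
  obtain ⟨N, hN⟩ : ∃ N : ℝ, N = (((Fintype.card V).choose 2 : ℕ) : ℝ) := ⟨_, rfl⟩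
  rw [← hN]
  set D := (Finset.univ : Finset (Sym2 V)).filter fun e => ¬ e.IsDiag with hD
  have hcard : (D.card : ℝ) = N := by
    rw [hD, card_filter_not_isDiag, hN]
  have hsq : ∫ G, (G.edgeSet.ncard : ℝ) ^ 2 ∂(SimpleGraph.binomialRandom V p) ≤
      N ^ 2 * (p : ℝ) ^ 2 + N * p := by
    have h : ∀ G : SimpleGraph V, (G.edgeSet.ncard : ℝ) ^ 2 =
        (((D ×ˢ D).filter fun x => x.1 ∈ G.edgeSet ∧ x.2 ∈ G.edgeSet).card : ℝ) := by
      intro G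
      rw [ncard_edgeSet_eq_card_filter, Finset.filter_product, Finset.card_product]
      push_cast
      ring
    simp_rw [h]
    rw [integral_card_filter _ _ (fun (x : Sym2 V × Sym2 V) (G : SimpleGraph V) =>
      x.1 ∈ G.edgeSet ∧ x.2 ∈ G.edgeSet), Finset.sum_product]
    have hp : 0 ≤ (p : ℝ) := p.2.1
    -- Distinct edges are independent, giving p^2, while a repeated edge gives p. The diagonal is
    -- bounded by p^2 + p so that the sum splits.
    calc ∑ e ∈ D, ∑ f ∈ D, (SimpleGraph.binomialRandom V p).real
            {G | e ∈ G.edgeSet ∧ f ∈ G.edgeSet}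
        ≤ ∑ e ∈ D, ∑ f ∈ D, ((p : ℝ) ^ 2 + if e = f then (p : ℝ) else 0) := by
          refine Finset.sum_le_sum fun e he => Finset.sum_le_sum fun f hf => ?_
          have h1 := binomialRandom_real_subset_edgeSet p {e, f} (by
            rw [hD, Finset.mem_filter] at he hf
            simpa using ⟨he.2, hf.2⟩)
          have h2 : (SimpleGraph.binomialRandom V p).real
              {G | e ∈ G.edgeSet ∧ f ∈ G.edgeSet} = (p : ℝ) ^ (({e, f} : Finset _).card) := by
            rw [← h1]; simp
          rw [h2]
          by_cases hef : e = f
          · subst hef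
            simp [sq_nonneg]
          · simp [hef, Finset.card_pair hef]
      _ = N ^ 2 * (p : ℝ) ^ 2 + N * p := by
          simp_rw [Finset.sum_add_distrib]
          simp only [Finset.sum_const, nsmul_eq_mul, Finset.sum_ite_eq, hcard]
          rw [Finset.sum_congr rfl (g := fun _ => (p : ℝ)) (fun x hx => if_pos hx),
            Finset.sum_const, nsmul_eq_mul, hcard]
          ring
  have hmean := integral_ncard_edgeSet (V := V) p
  rw [← hN] at hmean
  have hexp : ∀ G : SimpleGraph V, ((G.edgeSet.ncard : ℝ) - N * p) ^ 2 =
      (G.edgeSet.ncard : ℝ) ^ 2 - 2 * (N * p) * (G.edgeSet.ncard : ℝ) + (N * p) ^ 2 := by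
    intro G; ring
  simp_rw [hexp]
  rw [integral_add Integrable.of_finite Integrable.of_finite,
    integral_sub Integrable.of_finite Integrable.of_finite, integral_const_mul, hmean,
    integral_const]
  simp only [probReal_univ, one_smul]
  nlinarith

/-- Closed cycles of length `L` in `G`, as injective maps from `ZMod L` to the vertices. -/
def cyclicMaps (G : SimpleGraph V) (L : ℕ) : Set (ZMod L → V) :=
  {v | Function.Injective v ∧ ∀ i, G.Adj (v i) (v (i + 1))}

/-- Two positions with the same edge in reversed direction would force 2 = 0 in `ZMod L`. Hence a
cyclic map uses L distinct edges and occurs with probability exactly p^L. -/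
theorem injective_cyclic_edges {L : ℕ} (hL : 3 ≤ L) {v : ZMod L → V}
    (hv : Function.Injective v) :
    Function.Injective fun i => s(v i, v (i + 1)) := by
  intro i j hij
  simp only [Sym2.eq_iff] at hij
  rcases hij with h | h
  · exact hv h.1
  · have h1 := hv h.1
    have h2 := hv h.2
    exfalso
    rw [h1] at h2
    have h3 : ((2 : ℕ) : ZMod L) = 0 := by
      have : j + 2 = j := by rw [← one_add_one_eq_two, ← add_assoc]; exact h2
      simpa using this
    rw [ZMod.natCast_eq_zero_iff] at h3
    exact absurd (Nat.le_of_dvd (by norm_num) h3) (by omega)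

/-- There are at most |V|^L injective maps, each occurring with probability p^L. Every cycle is
counted once per starting point and direction, a constant factor that an upper bound can ignore. -/
theorem integral_ncard_cyclicMaps_le [Fintype V] (p : unitInterval) {L : ℕ} (hL : 3 ≤ L) :
    ∫ G, ((cyclicMaps G L).ncard : ℝ) ∂(SimpleGraph.binomialRandom V p) ≤
      ((Fintype.card V : ℝ) * p) ^ L := by
  classical
  have : NeZero L := ⟨by omega⟩
  set D := (Finset.univ : Finset (ZMod L → V)).filter Function.Injective with hD
  have h : ∀ G : SimpleGraph V, ((cyclicMaps G L).ncard : ℝ) =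
      ((D.filter fun v => ∀ i, G.Adj (v i) (v (i + 1))).card : ℝ) := by
    intro G
    rw [← Set.ncard_coe_finset]
    congr 2
    ext v
    simp [cyclicMaps, hD]
  have hp : 0 ≤ (p : ℝ) := p.2.1
  simp_rw [h]
  rw [integral_card_filter _ _ (fun (v : ZMod L → V) (G : SimpleGraph V) =>
    ∀ i, G.Adj (v i) (v (i + 1)))]
  calc ∑ v ∈ D, (SimpleGraph.binomialRandom V p).real {G | ∀ i, G.Adj (v i) (v (i + 1))}
      = ∑ v ∈ D, (p : ℝ) ^ L := by
        refine Finset.sum_congr rfl fun v hv => ?_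
        have hv' : Function.Injective v := by simpa [hD] using hv
        have h1 := binomialRandom_real_subset_edgeSet p
          (Finset.univ.image fun i => s(v i, v (i + 1))) (by
            simp only [Finset.mem_image, Finset.mem_univ, true_and, forall_exists_index,
              forall_apply_eq_imp_iff, Sym2.mk_isDiag_iff]
            intro i hi
            have h3 : ((1 : ℕ) : ZMod L) = 0 := by
              have := hv' hi
              simpa using this.symm
            rw [ZMod.natCast_eq_zero_iff] at h3
            exact absurd (Nat.le_of_dvd (by norm_num) h3) (by omega))
        rw [Finset.card_image_of_injective _ (injective_cyclic_edges hL hv'), Finset.card_univ,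
          ZMod.card] at h1
        rw [← h1]
        simp
    _ ≤ ((Fintype.card V : ℝ) * p) ^ L := by
        rw [Finset.sum_const, nsmul_eq_mul, mul_pow]
        refine mul_le_mul_of_nonneg_right ?_ (pow_nonneg hp _)
        have : D.card ≤ Fintype.card V ^ L := by
          refine (Finset.card_le_univ _).trans ?_
          simp [ZMod.card]
        exact_mod_cast this

end RandomGraph

/-! ### Counting faces and non-faces of a fixed graph -/

section Counting

variable {V : Type*} {G : SimpleGraph V}

/-- Vertex sets of size `l` without antipodal pairs are counted by choosing `l` edges
and an orientation of each of them. -/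
theorem ncard_not_hasAntipodalPair [Finite V] (G : SimpleGraph V) (l : ℕ) :
    {F : Finset G.Dart | ¬ HasAntipodalPair F ∧ F.card = l}.ncard =
      G.edgeSet.ncard.choose l * 2 ^ l := by
  classical
  have := Fintype.ofFinite V
  have ho : ∀ e : G.edgeSet, ∃ d : G.Dart, d.edge = e := by
    rintro ⟨e, he⟩
    induction e with
    | _ a b => exact ⟨⟨(a, b), he⟩, rfl⟩
  choose o ho using ho
  let ed : G.Dart → G.edgeSet := fun d => ⟨d.edge, d.edge_mem⟩
  have hedo : ∀ e, ed (o e) = e := fun e => Subtype.ext (ho e)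
  have heds : ∀ e, ed (o e).symm = e := fun e =>
    Subtype.ext ((SimpleGraph.Dart.edge_symm _).trans (ho e))
  -- With `o` as reference orientation, `U` records the edges oriented by `o`; all others are
  -- reversed. The sets counted correspond to pairs `U ⊆ T` with `T` an `l`-set of edges.
  let φ : Finset G.edgeSet → G.edgeSet → G.Dart := fun U e => if e ∈ U then o e else (o e).symm
  have hφ : ∀ U e, ed (φ U e) = e := by
    intro U e
    simp only [φ]
    split_ifs
    · exact hedo e
    · exact heds e
  have hφinj : ∀ U, Function.Injective (φ U) := fun U =>
    Function.LeftInverse.injective (g := ed) (hφ U)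
  have hcases : ∀ d, d = o (ed d) ∨ d = (o (ed d)).symm := fun d =>
    SimpleGraph.dart_edge_eq_iff _ _ |>.1 (ho (ed d)).symm
  have hset : {F : Finset G.Dart | ¬ HasAntipodalPair F ∧ F.card = l} =
      ((Finset.univ.filter fun F : Finset G.Dart => ¬ HasAntipodalPair F ∧ F.card = l :
        Finset (Finset G.Dart)) : Set (Finset G.Dart)) := by
    ext F; simp
  rw [hset, Set.ncard_coe_finset]
  have hX : G.edgeSet.ncard = (Finset.univ : Finset G.edgeSet).card := by
    rw [Finset.card_univ, ← Nat.card_eq_fintype_card]; rfl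
  have hcount : (((Finset.univ : Finset G.edgeSet).powersetCard l).sigma
      fun T => T.powerset).card = G.edgeSet.ncard.choose l * 2 ^ l := by
    rw [Finset.card_sigma, Finset.sum_congr rfl (g := fun _ => 2 ^ l), Finset.sum_const,
      Finset.card_powersetCard, hX, smul_eq_mul]
    intro T hT
    rw [Finset.card_powerset, (Finset.mem_powersetCard.1 hT).2]
  rw [← hcount]
  symm
  refine Finset.card_bij (fun x _ => x.1.image (φ x.2)) ?_ ?_ ?_
  · rintro ⟨T, U⟩ h
    simp only [Finset.mem_sigma, Finset.mem_powersetCard, Finset.mem_powerset] at h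
    simp only [Finset.mem_filter, Finset.mem_univ, true_and]
    refine ⟨?_, by rw [Finset.card_image_of_injective _ (hφinj U), h.1.2]⟩
    rintro ⟨d, h1, h2⟩
    rw [Finset.mem_image] at h1 h2
    obtain ⟨e, -, rfl⟩ := h1
    obtain ⟨f, -, hf⟩ := h2
    have h3 := congrArg ed hf
    have h4 : ed (φ U e).symm = ed (φ U e) := Subtype.ext (SimpleGraph.Dart.edge_symm _)
    rw [hφ, h4, hφ] at h3
    subst h3
    exact (φ U f).symm_ne hf.symm
  · rintro ⟨T, U⟩ h ⟨T', U'⟩ h' heq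
    simp only [Finset.mem_sigma, Finset.mem_powersetCard, Finset.mem_powerset] at h h' heq
    have himage : ∀ (T U : Finset G.edgeSet), (T.image (φ U)).image ed = T := by
      intro T U
      rw [Finset.image_image]
      have : ed ∘ φ U = id := funext (hφ U)
      rw [this, Finset.image_id]
    have hT : T = T' := by rw [← himage T U, heq, himage]
    subst hT
    have hmem : ∀ U : Finset G.edgeSet, ∀ e, e ∈ T → (e ∈ U ↔ o e ∈ T.image (φ U)) := by
      intro U e he
      constructor
      · intro hU
        exact Finset.mem_image.2 ⟨e, he, if_pos hU⟩
      · intro hU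
        obtain ⟨f, -, hf⟩ := Finset.mem_image.1 hU
        have h3 := congrArg ed hf
        rw [hφ, hedo] at h3
        subst h3
        by_contra hn
        simp only [φ, if_neg hn] at hf
        exact (o f).symm_ne hf
    have hU : U = U' := by
      ext e
      constructor
      · intro he
        rw [hmem U' e (h.2 he), ← heq, ← hmem U e (h.2 he)]
        exact he
      · intro he
        rw [hmem U e (h'.2 he), heq, ← hmem U' e (h'.2 he)]
        exact he
    rw [hU]
  · intro F hF
    simp only [Finset.mem_filter, Finset.mem_univ, true_and] at hF
    obtain ⟨hF, hcard⟩ := hF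
    have hsymm : ∀ d ∈ F, d.symm ∉ F := fun d h1 h2 => hF ⟨d, h1, h2⟩
    set U := (F.image ed).filter fun e => o e ∈ F with hU
    have hφF : ∀ d ∈ F, φ U (ed d) = d := by
      intro d hd
      have hd' : ed d ∈ F.image ed := Finset.mem_image_of_mem _ hd
      rcases hcases d with h | h
      · have : ed d ∈ U := by
          rw [hU, Finset.mem_filter]; exact ⟨hd', h ▸ hd⟩
        simp only [φ, if_pos this]
        exact h.symm
      · have : ed d ∉ U := by
          rw [hU, Finset.mem_filter]
          intro hh
          apply hsymm _ hh.2
          rw [← h]; exact hd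
        simp only [φ, if_neg this]
        exact h.symm
    have hinj : Set.InjOn ed F := by
      intro d hd d' hd' h
      rw [← hφF d hd, h, hφF d' hd']
    refine ⟨⟨F.image ed, U⟩, ?_, ?_⟩
    · simp only [Finset.mem_sigma, Finset.mem_powersetCard, Finset.mem_powerset]
      exact ⟨⟨Finset.subset_univ _, by rw [Finset.card_image_of_injOn hinj, hcard]⟩,
        Finset.filter_subset _ _⟩
    · simp only
      rw [Finset.image_image]
      exact (Finset.image_congr hφF).trans Finset.image_id

/-- A face contains no antipodal pair, so the two families partition the antipodal-free `l`-sets.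
For `l = 0` the empty set counts as a non-face. -/
theorem numFaces_add_numNonfaces [Finite V] (G : SimpleGraph V) (ord : LinearOrder G.edgeSet)
    (l : ℕ) :
    numFaces G ord l + numNonfaces G ord l = G.edgeSet.ncard.choose l * 2 ^ l := by
  classical
  have := Fintype.ofFinite V
  rw [← ncard_not_hasAntipodalPair, numFaces, numNonfaces,
    ← Set.ncard_union_eq (Set.disjoint_left.2 fun F h1 h2 => h2.1 h1.1)
      (Set.toFinite _) (Set.toFinite _)]
  congr 1
  ext F
  simp only [Set.mem_union, Set.mem_ofPred_eq]
  have h : F ∈ (triangulation G ord).faces → ¬ HasAntipodalPair F := fun h hF => h.2 (Or.inl hF)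
  tauto

theorem numNonfaces_one [Finite V] (G : SimpleGraph V) (ord : LinearOrder G.edgeSet) :
    numNonfaces G ord 1 = 0 := by
  have : {F : Finset G.Dart | F ∉ (triangulation G ord).faces ∧ ¬ HasAntipodalPair F ∧
      F.card = 1} = ∅ := by
    rw [Set.eq_empty_iff_forall_notMem]
    rintro F ⟨h1, -, h3⟩
    obtain ⟨d, rfl⟩ := Finset.card_eq_one.1 h3
    exact h1 ((triangulation G ord).singleton_mem d)
  rw [numNonfaces, this, Set.ncard_empty]

/-- Passes from cycles as walks to maps on `ZMod`, where the closing dart needs no special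
treatment. -/
theorem exists_mem_cyclicMaps {u : V} (c : G.Walk u u) (hc : c.IsCycle) :
    ∃ w ∈ cyclicMaps G c.length, ∀ d ∈ c.darts, ∃ i, d.fst = w i ∧ d.snd = w (i + 1) := by
  have hL := hc.three_le_length
  have : NeZero c.length := ⟨by omega⟩
  have : Fact (1 < c.length) := ⟨by omega⟩
  have hsucc : ∀ i : ZMod c.length, c.getVert (i + 1).val = c.getVert (i.val + 1) := by
    intro i
    have hi := ZMod.val_lt i
    rw [ZMod.val_add, ZMod.val_one]
    rcases Nat.lt_or_ge (i.val + 1) c.length with h | h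
    · rw [Nat.mod_eq_of_lt h]
    · have : i.val + 1 = c.length := by omega
      rw [this, Nat.mod_self, SimpleGraph.Walk.getVert_zero, SimpleGraph.Walk.getVert_length]
  refine ⟨fun i => c.getVert i.val, ⟨?_, ?_⟩, ?_⟩
  · intro i j hij
    have hi := ZMod.val_lt i
    have hj := ZMod.val_lt j
    exact ZMod.val_injective _ (hc.getVert_injOn' (by simp; omega) (by simp; omega) hij)
  · intro i
    simp only [hsucc]
    exact c.adj_getVert_succ (ZMod.val_lt i)
  · intro d hd
    obtain ⟨n, hn, rfl⟩ := List.getElem_of_mem hd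
    have hn' : n < c.length := by simpa using hn
    refine ⟨(n : ZMod c.length), ?_, ?_⟩
    · simp only [SimpleGraph.Walk.darts_getElem_eq_getVert, ZMod.val_natCast,
        Nat.mod_eq_of_lt hn']
    · simp only [SimpleGraph.Walk.darts_getElem_eq_getVert, hsucc, ZMod.val_natCast,
        Nat.mod_eq_of_lt hn']

theorem card_dart [Finite V] (G : SimpleGraph V) : Nat.card G.Dart = 2 * G.edgeSet.ncard := by
  classical
  have := Fintype.ofFinite V
  rw [← SimpleGraph.coe_edgeFinset, Set.ncard_coe_finset, ← G.dart_card_eq_twice_card_edges,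
    Nat.card_eq_fintype_card]

/-- The number of `l`-element vertex sets containing `m` darts of an oriented `L`-cycle. -/
theorem ncard_contains_part_of_cycle_le [Finite V] (G : SimpleGraph V) {l m L : ℕ} (hL : L ≠ 0) :
    {F : Finset G.Dart | F.card = l ∧ ∃ S ⊆ F, S.card = m ∧
        ∃ (v : V) (c : G.Walk v v), c.IsCycle ∧ c.length = L ∧ ∀ d ∈ S, d ∈ c.darts}.ncard ≤
      (cyclicMaps G L).ncard * 2 ^ L * (2 * G.edgeSet.ncard) ^ (l - m) := by
  classical
  have := Fintype.ofFinite V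
  have : NeZero L := ⟨hL⟩
  -- Decoding map: a cycle, a set of positions on it, and the `l - m` remaining darts determine `F`.
  -- It need only hit every `F` in question; injectivity plays no role.
  let dec : cyclicMaps G L × Finset (ZMod L) × {R : Finset G.Dart // R.card = l - m} →
      Finset G.Dart := fun x =>
    x.2.1.image (fun i => ⟨(x.1.1 i, x.1.1 (i + 1)), x.1.2.2 i⟩) ∪ x.2.2.1
  have hsub : {F : Finset G.Dart | F.card = l ∧ ∃ S ⊆ F, S.card = m ∧
      ∃ (v : V) (c : G.Walk v v), c.IsCycle ∧ c.length = L ∧ ∀ d ∈ S, d ∈ c.darts} ⊆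
      Set.range dec := by
    rintro F ⟨hF, S, hSF, hS, v, c, hc, rfl, hcS⟩
    obtain ⟨w, hw, hwd⟩ := exists_mem_cyclicMaps c hc
    refine ⟨⟨⟨w, hw⟩, Finset.univ.filter fun i => (⟨(w i, w (i + 1)), hw.2 i⟩ : G.Dart) ∈ S,
      ⟨F \ S, by rw [Finset.card_sdiff_of_subset hSF, hF, hS]⟩⟩, ?_⟩
    have himg : (Finset.univ.filter fun i =>
        (⟨(w i, w (i + 1)), hw.2 i⟩ : G.Dart) ∈ S).image
          (fun i => (⟨(w i, w (i + 1)), hw.2 i⟩ : G.Dart)) = S := by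
      ext d
      simp only [Finset.mem_image, Finset.mem_filter, Finset.mem_univ, true_and]
      constructor
      · rintro ⟨i, hi, rfl⟩
        exact hi
      · intro hd
        obtain ⟨i, h1, h2⟩ := hwd d (hcS d hd)
        have hd' : (⟨(w i, w (i + 1)), hw.2 i⟩ : G.Dart) = d := by
          ext
          · exact h1.symm
          · exact h2.symm
        exact ⟨i, hd' ▸ hd, hd'⟩
    simp only [dec]
    rw [himg, Finset.union_sdiff_of_subset hSF]
  refine (Set.ncard_le_ncard hsub (Set.toFinite _)).trans ?_
  rw [← Set.image_univ]
  refine (Set.ncard_image_le (Set.toFinite _)).trans ?_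
  rw [Set.ncard_univ, Nat.card_prod, Nat.card_prod, ← mul_assoc, Nat.card_coe_set_eq]
  refine Nat.mul_le_mul (Nat.mul_le_mul le_rfl ?_) ?_
  · simp [ZMod.card]
  · rw [Nat.card_eq_fintype_card, Fintype.card_finset_len, ← Nat.card_eq_fintype_card, card_dart]
    exact Nat.choose_le_pow _ _

/-- The minimal-edge condition on even cycles is dropped, so the bound holds for every order. The
sum starts at 2 because cycles have length at least 3; `1 ≤ l` excludes the empty set. -/
theorem numNonfaces_le [Finite V] (G : SimpleGraph V) (ord : LinearOrder G.edgeSet) {l : ℕ}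
    (hl : 1 ≤ l) :
    numNonfaces G ord l ≤ ∑ m ∈ Finset.Icc 2 l,
      ((cyclicMaps G (2 * m - 1)).ncard * 2 ^ (2 * m - 1) * (2 * G.edgeSet.ncard) ^ (l - m) +
        (cyclicMaps G (2 * m)).ncard * 2 ^ (2 * m) * (2 * G.edgeSet.ncard) ^ (l - m)) := by
  classical
  have := Fintype.ofFinite V
  let A : ℕ → ℕ → Set (Finset G.Dart) := fun m L =>
    {F | F.card = l ∧ ∃ S ⊆ F, S.card = m ∧
        ∃ (v : V) (c : G.Walk v v), c.IsCycle ∧ c.length = L ∧ ∀ d ∈ S, d ∈ c.darts}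
  have hsub : {F : Finset G.Dart | F ∉ (triangulation G ord).faces ∧ ¬ HasAntipodalPair F ∧
      F.card = l} ⊆ ⋃ m ∈ Finset.Icc 2 l, (A m (2 * m - 1) ∪ A m (2 * m)) := by
    rintro F ⟨h1, h2, h3⟩
    have hne : F.Nonempty := Finset.card_pos.1 (by omega)
    have hnon : IsNonface ord F := by
      by_contra h
      exact h1 ⟨hne, h⟩
    simp only [Set.mem_iUnion, Finset.mem_Icc, exists_prop]
    rcases hnon with h | ⟨S, hSF, ⟨v, c, hc, hlen, hcS⟩ | ⟨v, c, hc, hlen, hcS⟩⟩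
    · exact absurd h h2
    · have h4 := hc.three_le_length
      have h5 := Finset.card_le_card hSF
      exact ⟨S.card, by omega, Or.inl ⟨h3, S, hSF, rfl, v, c, hc, by omega, hcS⟩⟩
    · have h4 := hc.three_le_length
      have h5 := Finset.card_le_card hSF
      exact ⟨S.card, by omega, Or.inr ⟨h3, S, hSF, rfl, v, c, hc, by omega,
        fun d hd => (hcS d hd).1⟩⟩
  refine (Set.ncard_le_ncard hsub (Set.toFinite _)).trans ?_
  refine (Finset.set_ncard_biUnion_le _ _).trans ?_
  refine Finset.sum_le_sum fun m hm => ?_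
  have hm2 := (Finset.mem_Icc.1 hm).1
  exact (Set.ncard_union_le _ _).trans (Nat.add_le_add
    (ncard_contains_part_of_cycle_le G (by omega)) (ncard_contains_part_of_cycle_le G (by omega)))

end Counting

/-! ### Asymptotics of binomial coefficients with real argument -/

section Asymptotics

theorem ringChoose_eq_prod (x : ℝ) (l : ℕ) :
    Ring.choose x l = (∏ i ∈ Finset.range l, (x - i)) / l.factorial := by
  rw [Ring.choose_eq_smul, ← descPochhammer_eval_eq_prod_range, smul_eq_mul, inv_mul_eq_div,
    ← Polynomial.aeval_eq_smeval, Polynomial.aeval_def, Polynomial.eval₂_eq_eval_map,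
    descPochhammer_map]

theorem tendsto_self_div_self : Tendsto (fun t : ℝ => t / t) atTop (𝓝 1) :=
  tendsto_const_nhds.congr' (by
     filter_upwards [eventually_ne_atTop 0] with t ht
     rw [div_self ht])

theorem tendsto_prod_sub_div_pow {a : ℝ → ℝ} (ha : Tendsto (fun t => a t / t) atTop (𝓝 1))
    (l : ℕ) :
    Tendsto (fun t => (∏ i ∈ Finset.range l, (a t - i)) / t ^ l) atTop (𝓝 1) := by
  have h : Tendsto (fun t => ∏ i ∈ Finset.range l, ((a t - i) / t)) atTop
      (𝓝 (∏ i ∈ Finset.range l, (1 : ℝ))) := by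
    refine tendsto_finsetProd _ fun i _ => ?_
    have h2 : Tendsto (fun t : ℝ => a t / t - (i : ℝ) / t) atTop (𝓝 (1 - 0)) :=
      ha.sub (tendsto_const_nhds.div_atTop tendsto_id)
    simpa [sub_div] using h2
  simpa [Finset.prod_div_distrib] using h

theorem tendsto_ringChoose_div_pow (l : ℕ) :
    Tendsto (fun t : ℝ => l.factorial * Ring.choose t l / t ^ l) atTop (𝓝 1) := by
  refine (tendsto_prod_sub_div_pow tendsto_self_div_self l).congr fun t => ?_
  rw [ringChoose_eq_prod, mul_div_cancel₀ _ (by positivity)]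

theorem tendsto_rpow_three_quarters_div :
    Tendsto (fun t : ℝ => t ^ (3 / 4 : ℝ) / t) atTop (𝓝 0) := by
  refine (tendsto_rpow_neg_atTop (y := 1 / 4) (by norm_num)).congr' ?_
  filter_upwards [eventually_gt_atTop 0] with t ht
  nth_rewrite 3 [← Real.rpow_one t]
  rw [← Real.rpow_sub ht]
  norm_num

/-- Binomial coefficients of numbers close to `t` are close to the binomial coefficient of `t`. -/
theorem eventually_ringChoose_close (l : ℕ) {ε : ℝ} (hε : 0 < ε) :
    ∀ᶠ t : ℝ in atTop, ∀ x : ℝ, |x - t| ≤ t ^ (3 / 4 : ℝ) →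
      2 ^ (-ε) * Ring.choose t l ≤ Ring.choose x l ∧
        Ring.choose x l ≤ 2 ^ ε * Ring.choose t l := by
  have ha : Tendsto (fun t : ℝ => (t - t ^ (3 / 4 : ℝ)) / t) atTop (𝓝 1) := by
    simpa [sub_div] using tendsto_self_div_self.sub tendsto_rpow_three_quarters_div
  have hb : Tendsto (fun t : ℝ => (t + t ^ (3 / 4 : ℝ)) / t) atTop (𝓝 1) := by
    simpa [add_div] using tendsto_self_div_self.add tendsto_rpow_three_quarters_div
  have hg := tendsto_prod_sub_div_pow tendsto_self_div_self l
  have hga := (tendsto_prod_sub_div_pow ha l).div hg one_ne_zero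
  have hgb := (tendsto_prod_sub_div_pow hb l).div hg one_ne_zero
  rw [div_one] at hga hgb
  have hlow : (2 : ℝ) ^ (-ε) < 1 := Real.rpow_lt_one_of_one_lt_of_neg (by norm_num) (by linarith)
  have hupp : (1 : ℝ) < 2 ^ ε := Real.one_lt_rpow (by norm_num) hε
  -- Together with `t > 2 * l` this makes every factor of the lower product positive, so products
  -- can be compared factor by factor.
  have hal : ∀ᶠ t : ℝ in atTop, 1 / 2 < (t - t ^ (3 / 4 : ℝ)) / t :=
    ha.eventually_const_lt (by norm_num)
  filter_upwards [hga.eventually_const_lt hlow, hgb.eventually_lt_const hupp, hal,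
    eventually_gt_atTop 0, eventually_gt_atTop (2 * (l : ℝ))] with t h2 h3 h4 ht htl x hx
  rw [lt_div_iff₀ ht] at h4
  have hl0 : (0 : ℝ) ≤ l := Nat.cast_nonneg l
  have hil : ∀ i ∈ Finset.range l, (i : ℝ) ≤ l := fun i hi => by
    exact_mod_cast (Finset.mem_range.1 hi).le
  rw [abs_le] at hx
  have hpos : 0 < ∏ i ∈ Finset.range l, (t - i) :=
    Finset.prod_pos fun i hi => by linarith [hil i hi]
  have htp : 0 < t ^ l := pow_pos ht l
  simp only [Pi.div_apply] at h2 h3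
  rw [div_div_div_cancel_right₀ htp.ne', lt_div_iff₀ hpos] at h2
  rw [div_div_div_cancel_right₀ htp.ne', div_lt_iff₀ hpos] at h3
  have hf : (0 : ℝ) < l.factorial := by positivity
  simp only [ringChoose_eq_prod]
  rw [← mul_div_assoc, ← mul_div_assoc, div_le_div_iff_of_pos_right hf,
    div_le_div_iff_of_pos_right hf]
  constructor
  · refine h2.le.trans (Finset.prod_le_prod (fun i hi => ?_) fun i hi => ?_)
    · linarith [hil i hi]
    · linarith
  · refine le_trans (Finset.prod_le_prod (fun i hi => ?_) fun i hi => ?_) h3.le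
    · linarith [hil i hi]
    · linarith

/-! ### Typical behaviour of G(n, n^(-β)) and bounds on typical graphs -/

variable {β : ℝ} (hβ : 0 < β)

instance (n : ℕ) : IsProbabilityMeasure (erdosRenyi hβ n) := by
  unfold erdosRenyi; infer_instance

theorem expectedEdges_eq (n : ℕ) : expectedEdges hβ n = n.choose 2 * (n : ℝ) ^ (-β) := by
  rw [expectedEdges, erdosRenyi, integral_ncard_edgeSet, Fintype.card_fin]

theorem expectedEdges_bounds {n : ℕ} (hn : 2 ≤ n) :
    (n : ℝ) ^ (2 - β) / 4 ≤ expectedEdges hβ n ∧ expectedEdges hβ n ≤ (n : ℝ) ^ (2 - β) / 2 := by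
  have hn' : (2 : ℝ) ≤ n := by exact_mod_cast hn
  have hn0 : (0 : ℝ) < n := by linarith
  have hp : 0 < (n : ℝ) ^ (-β) := Real.rpow_pos_of_pos hn0 _
  rw [expectedEdges_eq, Nat.cast_choose_two, sub_eq_add_neg, Real.rpow_add hn0, Real.rpow_two]
  constructor <;> nlinarith [mul_nonneg hp.le (mul_nonneg hn0.le (sub_nonneg.2 hn')),
    mul_nonneg hp.le hn0.le]

theorem tendsto_expectedEdges (hβ1 : β < 1) :
    Tendsto (fun n => expectedEdges hβ n) atTop atTop := by
  have h : Tendsto (fun n : ℕ => (n : ℝ) ^ (2 - β) / 4) atTop atTop :=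
    ((tendsto_rpow_atTop (by linarith)).comp tendsto_natCast_atTop_atTop).atTop_div_const
      (by norm_num)
  refine tendsto_atTop_mono' _ ?_ h
  filter_upwards [eventually_ge_atTop 2] with n hn
  exact (expectedEdges_bounds hβ hn).1

/-- Chebyshev: the variance is at most μ, so the probability is at most μ / μ^(3/2) = μ^(-1/2). -/
theorem tendsto_prob_edges_far (hβ1 : β < 1) :
    Tendsto (fun n => (erdosRenyi hβ n).real {G | ¬ |(G.edgeSet.ncard : ℝ) - expectedEdges hβ n| ≤
      expectedEdges hβ n ^ (3 / 4 : ℝ)}) atTop (𝓝 0) := by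
  have hμ := tendsto_expectedEdges hβ hβ1
  have hlim : Tendsto (fun n => expectedEdges hβ n ^ (-(1 / 2) : ℝ)) atTop (𝓝 0) :=
    (tendsto_rpow_neg_atTop (by norm_num)).comp hμ
  refine squeeze_zero' (Eventually.of_forall fun _ => measureReal_nonneg) ?_ hlim
  filter_upwards [hμ.eventually_gt_atTop 0] with n hn
  set μ := expectedEdges hβ n with hμdef
  have hvar : ∫ G, ((G.edgeSet.ncard : ℝ) - μ) ^ 2 ∂(erdosRenyi hβ n) ≤ μ := by
    have h := integral_ncard_edgeSet_sub_sq_le (V := Fin n)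
      ⟨(n : ℝ) ^ (-β), rpow_neg_mem_unitInterval hβ n⟩
    rw [Fintype.card_fin] at h
    simp only at h
    rw [← expectedEdges_eq hβ] at h
    exact h
  have hmarkov := mul_meas_ge_le_integral_of_nonneg (μ := erdosRenyi hβ n)
    (f := fun G => ((G.edgeSet.ncard : ℝ) - μ) ^ 2) (Eventually.of_forall fun _ => sq_nonneg _)
    Integrable.of_finite (μ ^ (3 / 2 : ℝ))
  have hpos : 0 < μ ^ (3 / 2 : ℝ) := Real.rpow_pos_of_pos hn _
  have hsub : {G : SimpleGraph (Fin n) | ¬ |(G.edgeSet.ncard : ℝ) - μ| ≤ μ ^ (3 / 4 : ℝ)} ⊆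
      {G | μ ^ (3 / 2 : ℝ) ≤ ((G.edgeSet.ncard : ℝ) - μ) ^ 2} := by
    intro G hG
    simp only [Set.mem_ofPred_eq, not_le] at hG ⊢
    have h1 : (μ ^ (3 / 4 : ℝ)) ^ 2 = μ ^ (3 / 2 : ℝ) := by
      rw [← Real.rpow_natCast, ← Real.rpow_mul hn.le]
      norm_num
    rw [← h1, ← sq_abs ((G.edgeSet.ncard : ℝ) - μ)]
    exact pow_le_pow_left₀ (Real.rpow_nonneg hn.le _) hG.le 2
  refine (measureReal_mono hsub).trans ?_
  have h2 : μ ^ (-(1 / 2) : ℝ) = μ / μ ^ (3 / 2 : ℝ) := by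
    nth_rewrite 2 [← Real.rpow_one μ]
    rw [← Real.rpow_sub hn]
    norm_num
  rw [h2, le_div_iff₀ hpos, mul_comm]
  exact hmarkov.trans hvar

theorem tendsto_prob_many_cycles (hβ1 : β < 1) {α : ℝ} (hα1 : α < 1)
    (hα : (2 - β) * α ≤ β) {L m : ℕ} (hL : 3 ≤ L) (hm : 2 ≤ m) (hLm : L ≤ 2 * m) :
    Tendsto (fun n => (erdosRenyi hβ n).real {G | ¬ ((cyclicMaps G L).ncard : ℝ) ≤
      expectedEdges hβ n ^ ((m : ℝ) - α)}) atTop (𝓝 0) := by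
  have hm' : (2 : ℝ) ≤ m := by exact_mod_cast hm
  have hLm' : (L : ℝ) ≤ 2 * m := by exact_mod_cast hLm
  have hma : 0 < (m : ℝ) - α := by linarith
  -- The exponent gained in Markov's inequality: the threshold is at least (n^(2-β)/4)^(m-α), the
  -- mean at most n^((1-β)L).
  set γ := (2 - β) * ((m : ℝ) - α) - (1 - β) * L with hγ
  have hγ0 : 0 < γ := by
    have h1 : (1 - β) * L ≤ (1 - β) * (2 * m) :=
      mul_le_mul_of_nonneg_left hLm' (by linarith)
    nlinarith
  have hlim : Tendsto (fun n : ℕ => (4 : ℝ) ^ ((m : ℝ) - α) * (n : ℝ) ^ (-γ)) atTop (𝓝 0) := by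
    have := ((tendsto_rpow_neg_atTop hγ0).comp tendsto_natCast_atTop_atTop).const_mul
      ((4 : ℝ) ^ ((m : ℝ) - α))
    simpa using this
  refine squeeze_zero' (Eventually.of_forall fun _ => measureReal_nonneg) ?_ hlim
  filter_upwards [eventually_ge_atTop 2] with n hn
  have hn0 : (0 : ℝ) < n := by
    have : (2 : ℝ) ≤ n := by exact_mod_cast hn
    linarith
  have hμ := (expectedEdges_bounds hβ hn).1
  set μ := expectedEdges hβ n with hμdef
  have hq : 0 < (n : ℝ) ^ (2 - β) / 4 := div_pos (Real.rpow_pos_of_pos hn0 _) (by norm_num)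
  have hμ0 : 0 < μ := hq.trans_le hμ
  have hmean : ∫ G, ((cyclicMaps G L).ncard : ℝ) ∂(erdosRenyi hβ n) ≤
      (n : ℝ) ^ ((1 - β) * L) := by
    have h := integral_ncard_cyclicMaps_le (V := Fin n)
      ⟨(n : ℝ) ^ (-β), rpow_neg_mem_unitInterval hβ n⟩ hL
    rw [Fintype.card_fin] at h
    simp only at h
    have h2 : (n : ℝ) * (n : ℝ) ^ (-β) = (n : ℝ) ^ (1 - β) := by
      rw [sub_eq_add_neg, Real.rpow_add hn0, Real.rpow_one]
    rw [h2, ← Real.rpow_natCast, ← Real.rpow_mul hn0.le] at h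
    exact h
  have hmarkov := mul_meas_ge_le_integral_of_nonneg (μ := erdosRenyi hβ n)
    (f := fun G => ((cyclicMaps G L).ncard : ℝ)) (Eventually.of_forall fun _ => Nat.cast_nonneg _)
    Integrable.of_finite (μ ^ ((m : ℝ) - α))
  have hsub : {G : SimpleGraph (Fin n) | ¬ ((cyclicMaps G L).ncard : ℝ) ≤ μ ^ ((m : ℝ) - α)} ⊆
      {G | μ ^ ((m : ℝ) - α) ≤ ((cyclicMaps G L).ncard : ℝ)} := fun G hG => (not_le.1 hG).le
  refine (measureReal_mono hsub).trans ?_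
  have hpow : ((n : ℝ) ^ (2 - β) / 4) ^ ((m : ℝ) - α) ≤ μ ^ ((m : ℝ) - α) :=
    Real.rpow_le_rpow hq.le hμ hma.le
  have hqpos : 0 < ((n : ℝ) ^ (2 - β) / 4) ^ ((m : ℝ) - α) := Real.rpow_pos_of_pos hq _
  have hrhs : (4 : ℝ) ^ ((m : ℝ) - α) * (n : ℝ) ^ (-γ) =
      (n : ℝ) ^ ((1 - β) * L) / ((n : ℝ) ^ (2 - β) / 4) ^ ((m : ℝ) - α) := by
    rw [Real.div_rpow (Real.rpow_nonneg hn0.le _) (by norm_num), ← Real.rpow_mul hn0.le,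
      div_div_eq_mul_div, hγ, neg_sub, Real.rpow_sub hn0]
    ring
  rw [hrhs, le_div_iff₀ hqpos]
  calc _ ≤ _ := mul_le_mul_of_nonneg_left hpow measureReal_nonneg
    _ ≤ _ := (mul_comm _ _).le.trans (hmarkov.trans hmean)

/-- Graphs whose number of edges is close to its mean and which have few short cycles. -/
def typicalGraphs (α : ℝ) (k n : ℕ) : Set (SimpleGraph (Fin n)) :=
  {G | |(G.edgeSet.ncard : ℝ) - expectedEdges hβ n| ≤ expectedEdges hβ n ^ (3 / 4 : ℝ) ∧
    ∀ m ∈ Finset.Icc 2 (k + 1),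
      ((cyclicMaps G (2 * m - 1)).ncard : ℝ) ≤ expectedEdges hβ n ^ ((m : ℝ) - α) ∧
      ((cyclicMaps G (2 * m)).ncard : ℝ) ≤ expectedEdges hβ n ^ ((m : ℝ) - α)}

theorem tendsto_prob_typicalGraphs (hβ1 : β < 1) {α : ℝ} (hα1 : α < 1)
    (hα : (2 - β) * α ≤ β) (k : ℕ) :
    Tendsto (fun n => (erdosRenyi hβ n).real (typicalGraphs hβ α k n)) atTop (𝓝 1) := by
  let bad : ℕ → (L m : ℕ) → ℝ := fun n L m => (erdosRenyi hβ n).real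
    {G | ¬ ((cyclicMaps G L).ncard : ℝ) ≤ expectedEdges hβ n ^ ((m : ℝ) - α)}
  have hlim : Tendsto (fun n => (erdosRenyi hβ n).real
      {G | ¬ |(G.edgeSet.ncard : ℝ) - expectedEdges hβ n| ≤ expectedEdges hβ n ^ (3 / 4 : ℝ)} +
      ∑ m ∈ Finset.Icc 2 (k + 1), (bad n (2 * m - 1) m + bad n (2 * m) m)) atTop
      (𝓝 (0 + ∑ m ∈ Finset.Icc 2 (k + 1), (0 + 0))) := by
    refine (tendsto_prob_edges_far hβ hβ1).add (tendsto_finsetSum _ fun m hm => ?_)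
    have hm2 := (Finset.mem_Icc.1 hm).1
    exact (tendsto_prob_many_cycles hβ hβ1 hα1 hα (by omega) hm2 (by omega)).add
      (tendsto_prob_many_cycles hβ hβ1 hα1 hα (by omega) hm2 (by omega))
  simp only [add_zero, Finset.sum_const_zero] at hlim
  have hcompl : Tendsto (fun n => (erdosRenyi hβ n).real (typicalGraphs hβ α k n)ᶜ) atTop
      (𝓝 0) := by
    refine squeeze_zero (fun _ => measureReal_nonneg) (fun n => ?_) hlim
    have hsub : (typicalGraphs hβ α k n)ᶜ ⊆
        {G | ¬ |(G.edgeSet.ncard : ℝ) - expectedEdges hβ n| ≤ expectedEdges hβ n ^ (3 / 4 : ℝ)} ∪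
        ⋃ m ∈ Finset.Icc 2 (k + 1),
          ({G | ¬ ((cyclicMaps G (2 * m - 1)).ncard : ℝ) ≤ expectedEdges hβ n ^ ((m : ℝ) - α)} ∪
            {G | ¬ ((cyclicMaps G (2 * m)).ncard : ℝ) ≤ expectedEdges hβ n ^ ((m : ℝ) - α)}) := by
      intro G hG
      by_contra h
      simp only [Set.mem_union, Set.mem_iUnion, Set.mem_ofPred_eq, not_or, not_not, not_exists]
        at h
      exact hG ⟨h.1, h.2⟩
    refine (measureReal_mono hsub).trans ((measureReal_union_le _ _).trans ?_)
    refine add_le_add le_rfl ((measureReal_biUnion_finset_le _ _).trans ?_)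
    exact Finset.sum_le_sum fun m _ => measureReal_union_le _ _
  have h := hcompl.const_sub 1
  rw [sub_zero] at h
  refine h.congr fun n => ?_
  rw [probReal_compl_eq_one_sub (Set.toFinite _).measurableSet, sub_sub_cancel]

/-- An event that holds for all typical graphs on many vertices holds
asymptotically almost surely. -/
theorem tendsto_prob_of_typicalGraphs (hβ1 : β < 1) {α : ℝ} (hα1 : α < 1)
    (hα : (2 - β) * α ≤ β) (k : ℕ) {A : (n : ℕ) → Set (SimpleGraph (Fin n))}
    (hA : ∀ᶠ n in atTop, ∀ G ∈ typicalGraphs hβ α k n, G ∈ A n) :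
    Tendsto (fun n => (erdosRenyi hβ n).real (A n)) atTop (𝓝 1) := by
  refine tendsto_of_tendsto_of_tendsto_of_le_of_le' (tendsto_prob_typicalGraphs hβ hβ1 hα1 hα k)
    tendsto_const_nhds ?_ (Eventually.of_forall fun _ => measureReal_le_one)
  filter_upwards [hA] with n hn
  exact measureReal_mono hn

theorem numNonfaces_le_of_mem_typicalGraphs {α : ℝ} {k n : ℕ} {G : SimpleGraph (Fin n)}
    (hG : G ∈ typicalGraphs hβ α k n) (hμ : 1 ≤ expectedEdges hβ n)
    (ord : LinearOrder G.edgeSet) {l : ℕ} (hl2 : 2 ≤ l) (hlk : l ≤ k + 1) :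
    (numNonfaces G ord l : ℝ) ≤
      2 * k * 4 ^ (k + 1) * expectedEdges hβ n ^ ((l : ℝ) - α) := by
  obtain ⟨hX, hC⟩ := hG
  set μ := expectedEdges hβ n with hμdef
  have hμ0 : 0 < μ := by linarith
  have hX2 : (2 * (G.edgeSet.ncard : ℝ)) ≤ 4 * μ := by
    have h1 : μ ^ (3 / 4 : ℝ) ≤ μ := by
      nth_rewrite 2 [← Real.rpow_one μ]
      exact Real.rpow_le_rpow_of_exponent_le hμ (by norm_num)
    linarith [(abs_le.1 hX).2]
  have hle : (numNonfaces G ord l : ℝ) ≤ _ := Nat.cast_le.2 (numNonfaces_le G ord (by omega))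
  refine hle.trans ?_
  push_cast
  have hP : 0 ≤ μ ^ ((l : ℝ) - α) := Real.rpow_nonneg hμ0.le _
  have hterm : ∀ m ∈ Finset.Icc 2 l, ∀ L ≤ 2 * m,
      ((cyclicMaps G L).ncard : ℝ) ≤ μ ^ ((m : ℝ) - α) →
      ((cyclicMaps G L).ncard : ℝ) * 2 ^ L * (2 * (G.edgeSet.ncard : ℝ)) ^ (l - m) ≤
        4 ^ (k + 1) * μ ^ ((l : ℝ) - α) := by
    intro m hm L hL hc
    have hml := (Finset.mem_Icc.1 hm).2
    have h2L : (2 : ℝ) ^ L ≤ 4 ^ m := by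
      rw [show (4 : ℝ) = 2 ^ 2 by norm_num, ← pow_mul]
      exact pow_le_pow_right₀ (by norm_num) hL
    have hsplit : μ ^ ((l : ℝ) - α) = μ ^ ((m : ℝ) - α) * μ ^ (l - m) := by
      rw [← Real.rpow_natCast, ← Real.rpow_add hμ0, Nat.cast_sub hml]
      congr 1; ring
    -- The factor 4^m bounds 2^L, and 4μ bounds twice the number of edges; together they give 4^l.
    calc ((cyclicMaps G L).ncard : ℝ) * 2 ^ L * (2 * (G.edgeSet.ncard : ℝ)) ^ (l - m)
        ≤ μ ^ ((m : ℝ) - α) * 4 ^ m * (4 * μ) ^ (l - m) := by gcongr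
      _ = 4 ^ l * μ ^ ((l : ℝ) - α) := by
          rw [hsplit, mul_pow, ← pow_mul_pow_sub 4 hml]; ring
      _ ≤ 4 ^ (k + 1) * μ ^ ((l : ℝ) - α) := by
          gcongr
          norm_num
  -- Two cycle lengths for each of the `l - 1 ≤ k` values of `m` yield the constant 2k · 4^(k+1).
  calc _ ≤ ∑ m ∈ Finset.Icc 2 l, (2 * (4 ^ (k + 1) * μ ^ ((l : ℝ) - α))) := by
        refine Finset.sum_le_sum fun m hm => ?_
        have hm' := Finset.mem_Icc.1 hm
        obtain ⟨h1, h2⟩ := hC m (Finset.mem_Icc.2 ⟨hm'.1, by omega⟩)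
        linarith [hterm m hm _ (by omega) h1, hterm m hm _ le_rfl h2]
    _ ≤ 2 * k * 4 ^ (k + 1) * μ ^ ((l : ℝ) - α) := by
        rw [Finset.sum_const, Nat.card_Icc, nsmul_eq_mul]
        have h1 : ((l + 1 - 2 : ℕ) : ℝ) ≤ k := by exact_mod_cast (by omega : l + 1 - 2 ≤ k)
        have h2 : 0 ≤ 4 ^ (k + 1) * μ ^ ((l : ℝ) - α) := by positivity
        nlinarith

/-- The factor 2^(±ε) absorbs the replacement of X by μ. The upper bound discards the non-faces; the
lower bound subtracts them, and for `l = 1` there are none. -/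
theorem eventually_numFaces_bounds (hβ1 : β < 1) (α : ℝ) {k : ℕ} {ε B : ℝ} (hε : 0 < ε)
    (hB : 2 * k * 4 ^ (k + 1) ≤ B) :
    ∀ᶠ n in atTop, ∀ G ∈ typicalGraphs hβ α k n, ∀ ord : LinearOrder G.edgeSet,
      ∀ l : ℕ, 1 ≤ l → l ≤ k →
        (2 : ℝ) ^ ((l : ℝ) - ε) * Ring.choose (expectedEdges hβ n) l
            - B * expectedEdges hβ n ^ ((l : ℝ) - α) ≤ (numFaces G ord l : ℝ) ∧
        (numFaces G ord l : ℝ) ≤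
          (2 : ℝ) ^ ((l : ℝ) + ε) * Ring.choose (expectedEdges hβ n) l := by
  have hμ := tendsto_expectedEdges hβ hβ1
  have hclose : ∀ᶠ t : ℝ in atTop, ∀ l ∈ Finset.Icc 1 k, ∀ x : ℝ, |x - t| ≤ t ^ (3 / 4 : ℝ) →
      2 ^ (-ε) * Ring.choose t l ≤ Ring.choose x l ∧
        Ring.choose x l ≤ 2 ^ ε * Ring.choose t l :=
    (Filter.eventually_all_finset _).2 fun l _ => eventually_ringChoose_close l hε
  filter_upwards [hμ.eventually hclose, hμ.eventually_ge_atTop 1] with n hn hμ1 G hG ord l hl hlk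
  obtain ⟨h1, h2⟩ := hn l (Finset.mem_Icc.2 ⟨hl, hlk⟩) _ hG.1
  rw [Ring.choose_natCast] at h1 h2
  have hsum : (numFaces G ord l : ℝ) + numNonfaces G ord l =
      (G.edgeSet.ncard.choose l : ℝ) * 2 ^ l := by
    exact_mod_cast numFaces_add_numNonfaces G ord l
  have hP : 0 ≤ expectedEdges hβ n ^ ((l : ℝ) - α) := Real.rpow_nonneg (by linarith) _
  have hN : (numNonfaces G ord l : ℝ) ≤ B * expectedEdges hβ n ^ ((l : ℝ) - α) := by
    have hB0 : 0 ≤ B := le_trans (by positivity) hB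
    rcases Nat.lt_or_ge 1 l with h | h
    · exact (numNonfaces_le_of_mem_typicalGraphs hβ hG hμ1 ord h (by omega)).trans
        (mul_le_mul_of_nonneg_right hB hP)
    · obtain rfl : l = 1 := by omega
      rw [numNonfaces_one, Nat.cast_zero]
      exact mul_nonneg hB0 hP
  have hN0 : (0 : ℝ) ≤ numNonfaces G ord l := Nat.cast_nonneg _
  have h2l : (0 : ℝ) < 2 ^ l := by positivity
  rw [sub_eq_add_neg (l : ℝ), Real.rpow_add two_pos, Real.rpow_add two_pos, Real.rpow_natCast]
  constructor <;> nlinarith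

theorem eventually_numFaces_theta (hβ1 : β < 1) {α : ℝ} (hα : 0 < α) (k : ℕ) :
    ∀ᶠ n : ℕ in atTop, ∀ G ∈ typicalGraphs hβ α k n, ∀ ord : LinearOrder G.edgeSet,
      ∀ l : ℕ, 1 ≤ l → l ≤ k →
        1 / (4 * k.factorial * 4 ^ k) * (n : ℝ) ^ ((2 - β) * (l : ℝ)) ≤ (numFaces G ord l : ℝ) ∧
        (numFaces G ord l : ℝ) ≤ 4 * (n : ℝ) ^ ((2 - β) * (l : ℝ)) := by
  have hμ := tendsto_expectedEdges hβ hβ1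
  have hchoose : ∀ᶠ t : ℝ in atTop, ∀ l ∈ Finset.Icc 1 k,
      1 / 2 < l.factorial * Ring.choose t l / t ^ l ∧
        l.factorial * Ring.choose t l / t ^ l < 2 :=
    (Filter.eventually_all_finset _).2 fun l _ =>
      ((tendsto_ringChoose_div_pow l).eventually_const_lt (by norm_num)).and
        ((tendsto_ringChoose_div_pow l).eventually_lt_const (by norm_num))
  -- The main term will be at least μ^l / (2 k!); the error, a multiple of μ^(-α) μ^l, must take at
  -- most half of it.
  have hsmall : ∀ᶠ t : ℝ in atTop,
      2 * k * 4 ^ (k + 1) * t ^ (-α) < 1 / (4 * k.factorial) := by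
    have h := (tendsto_rpow_neg_atTop hα).const_mul (2 * (k : ℝ) * 4 ^ (k + 1))
    rw [mul_zero] at h
    exact h.eventually_lt_const (by positivity)
  filter_upwards [eventually_numFaces_bounds hβ hβ1 α (k := k) one_pos le_rfl,
    hμ.eventually hchoose, hμ.eventually hsmall, hμ.eventually_gt_atTop 0,
    eventually_ge_atTop 2] with n hn hch hsm hμ0 hn2 G hG ord l hl hlk
  obtain ⟨hlow, hupp⟩ := hn G hG ord l hl hlk
  obtain ⟨hc1, hc2⟩ := hch l (Finset.mem_Icc.2 ⟨hl, hlk⟩)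
  obtain ⟨hb1, hb2⟩ := expectedEdges_bounds hβ hn2
  set μ := expectedEdges hβ n with hμdef
  have hn0 : (0 : ℝ) ≤ n := Nat.cast_nonneg n
  have hpl : 0 < μ ^ l := pow_pos hμ0 l
  rw [lt_div_iff₀ hpl] at hc1
  rw [div_lt_iff₀ hpl] at hc2
  have hnl : (n : ℝ) ^ ((2 - β) * (l : ℝ)) = ((n : ℝ) ^ (2 - β)) ^ l := by
    rw [Real.rpow_mul hn0, Real.rpow_natCast]
  set q := (n : ℝ) ^ (2 - β) with hq
  have hq0 : 0 ≤ q := Real.rpow_nonneg hn0 _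
  have hf1 : (1 : ℝ) ≤ l.factorial := by exact_mod_cast Nat.factorial_pos l
  have hfk : (l.factorial : ℝ) ≤ k.factorial := by exact_mod_cast Nat.factorial_le hlk
  have hfk0 : (0 : ℝ) < k.factorial := by positivity
  rw [hnl]
  constructor
  · refine le_trans ?_ hlow
    have h1 : (1 : ℝ) ≤ 2 ^ ((l : ℝ) - 1) :=
      Real.one_le_rpow (by norm_num) (by
        have : (1 : ℝ) ≤ l := by exact_mod_cast hl
        linarith)
    have h2 : μ ^ l / (2 * k.factorial) ≤ Ring.choose μ l := by
      rw [div_le_iff₀ (by positivity)]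
      have hch0 : 0 ≤ Ring.choose μ l := by
        by_contra hneg
        push Not at hneg
        nlinarith
      nlinarith [mul_le_mul_of_nonneg_right hfk hch0]
    have h3 : μ ^ ((l : ℝ) - α) = μ ^ (-α) * μ ^ l := by
      rw [sub_eq_neg_add, Real.rpow_add hμ0, Real.rpow_natCast]
    have h4 : q ^ l / 4 ^ k ≤ μ ^ l := by
      calc q ^ l / 4 ^ k ≤ q ^ l / 4 ^ l := by
            gcongr
            norm_num
        _ = (q / 4) ^ l := by rw [div_pow]
        _ ≤ μ ^ l := pow_le_pow_left₀ (by positivity) hb1 l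
    calc 1 / (4 * k.factorial * 4 ^ k) * q ^ l
        = 1 / (4 * k.factorial) * (q ^ l / 4 ^ k) := by
          field_simp
      _ ≤ 1 / (4 * k.factorial) * μ ^ l := by gcongr
      _ = μ ^ l / (2 * k.factorial) - 1 / (4 * k.factorial) * μ ^ l := by
          field_simp; ring
      _ ≤ _ := by
          rw [h3, ← mul_assoc]
          refine sub_le_sub ?_ (mul_le_mul_of_nonneg_right hsm.le hpl.le)
          have h5 : 0 ≤ Ring.choose μ l := le_trans (by positivity) h2
          nlinarith
  · refine hupp.trans ?_
    have h1 : Ring.choose μ l ≤ 2 * μ ^ l := by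
      rcases le_or_gt (Ring.choose μ l) 0 with h | h
      · exact h.trans (by positivity)
      · nlinarith
    -- From μ ≤ q / 2. The constant 4 then combines the 2 from ε = 1 with the 2 bounding the
    -- binomial coefficient.
    have h2 : (2 : ℝ) ^ l * μ ^ l ≤ q ^ l := by
      rw [← mul_pow]
      exact pow_le_pow_left₀ (by positivity) (by linarith) l
    rw [Real.rpow_add two_pos, Real.rpow_natCast, Real.rpow_one]
    have h3 : (0 : ℝ) < 2 ^ l := by positivity
    nlinarith [mul_le_mul_of_nonneg_left h1 h3.le]

end Asymptotics

end SymEdge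

theorem mainTheorem9 (β : ℝ) (hβ0 : 0 < β) (hβ1 : β < 1) (α : ℝ)
    (hα : α = min (1 / 2) (β / (2 - β))) (k : ℕ) (hk : 1 ≤ k) :
    (∃ B₀ : ℝ, 0 < B₀ ∧ ∀ B : ℝ, B₀ ≤ B →
      ∀ ord : (n : ℕ) → (G : SimpleGraph (Fin n)) → LinearOrder G.edgeSet,
        Tendsto (fun n : ℕ => (SymEdge.erdosRenyi hβ0 n).real
          {G | ∀ l : ℕ, 2 ≤ l → l ≤ k + 1 →
            (SymEdge.numNonfaces G (ord n G) l : ℝ)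
              ≤ B * SymEdge.expectedEdges hβ0 n ^ ((l : ℝ) - α)})
          atTop (𝓝 1)) ∧
    (∃ B₀ : ℝ, 0 < B₀ ∧ ∀ B : ℝ, B₀ ≤ B → ∀ ε : ℝ, 0 < ε →
      ∀ ord : (n : ℕ) → (G : SimpleGraph (Fin n)) → LinearOrder G.edgeSet,
        Tendsto (fun n : ℕ => (SymEdge.erdosRenyi hβ0 n).real
          {G | ∀ l : ℕ, 1 ≤ l → l ≤ k →
            (2 : ℝ) ^ ((l : ℝ) - ε) * Ring.choose (SymEdge.expectedEdges hβ0 n) l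
                - B * SymEdge.expectedEdges hβ0 n ^ ((l : ℝ) - α)
              ≤ (SymEdge.numFaces G (ord n G) l : ℝ) ∧
            (SymEdge.numFaces G (ord n G) l : ℝ)
              ≤ (2 : ℝ) ^ ((l : ℝ) + ε) * Ring.choose (SymEdge.expectedEdges hβ0 n) l})
          atTop (𝓝 1)) ∧
    (∃ c C : ℝ, 0 < c ∧ 0 < C ∧
      ∀ ord : (n : ℕ) → (G : SimpleGraph (Fin n)) → LinearOrder G.edgeSet,
        Tendsto (fun n : ℕ => (SymEdge.erdosRenyi hβ0 n).real
          {G | ∀ l : ℕ, 1 ≤ l → l ≤ k →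
            c * (n : ℝ) ^ ((2 - β) * (l : ℝ)) ≤ (SymEdge.numFaces G (ord n G) l : ℝ) ∧
            (SymEdge.numFaces G (ord n G) l : ℝ) ≤ C * (n : ℝ) ^ ((2 - β) * (l : ℝ))})
          atTop (𝓝 1)) := by
  have h2β : (0 : ℝ) < 2 - β := by linarith
  have hα0 : 0 < α := by
    rw [hα]
    exact lt_min (by norm_num) (div_pos hβ0 h2β)
  have hα1 : α < 1 := by
    rw [hα]
    exact (min_le_left _ _).trans_lt (by norm_num)
  have hαβ : (2 - β) * α ≤ β := by
    have h : α ≤ β / (2 - β) := hα ▸ min_le_right _ _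
    rw [le_div_iff₀ h2β] at h
    linarith
  have hk0 : (0 : ℝ) < k := by exact_mod_cast hk
  have hB₀ : (0 : ℝ) < 2 * k * 4 ^ (k + 1) := by positivity
  refine ⟨⟨_, hB₀, fun B hB ord => ?_⟩, ⟨_, hB₀, fun B hB ε hε ord => ?_⟩,
    ⟨1 / (4 * k.factorial * 4 ^ k), 4, by positivity, by norm_num, fun ord => ?_⟩⟩
  · refine SymEdge.tendsto_prob_of_typicalGraphs hβ0 hβ1 hα1 hαβ k ?_
    filter_upwards [(SymEdge.tendsto_expectedEdges hβ0 hβ1).eventually_ge_atTop 1]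
      with n hn G hG l hl hlk
    exact (SymEdge.numNonfaces_le_of_mem_typicalGraphs hβ0 hG hn (ord n G) hl hlk).trans
      (mul_le_mul_of_nonneg_right hB (Real.rpow_nonneg (by linarith) _))
  · refine SymEdge.tendsto_prob_of_typicalGraphs hβ0 hβ1 hα1 hαβ k ?_
    filter_upwards [SymEdge.eventually_numFaces_bounds hβ0 hβ1 α hε hB] with n hn G hG
    exact hn G hG (ord n G)
  · refine SymEdge.tendsto_prob_of_typicalGraphs hβ0 hβ1 hα1 hαβ k ?_
    filter_upwards [SymEdge.eventually_numFaces_theta hβ0 hβ1 hα0 k] with n hn G hG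
    exact hn G hG (ord n G)
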